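/- **Conventions.** $HTop_*$ is the category of pointed topological spaces and pointed homotopy classes of pointed maps. $HPol_*$ is its full subcategory of the pointed spaces that have the pointed homotopy type of a pointed polyhedron (geometric realization of a simplicial complex). An inverse system $\mathbf X=(X_\lambda,p_{\lambda\lambda'},\Lambda)$ in a category $\mathcal C$ is indexed by a nonempty directed preordered set. It is *movable* if every $\lambda\in\Lambda$ admits $\lambda'\ge\lambda$ such that for each $\lambda''\ge\lambda$ there is a morphism $r:X_{\lambda'}\to X_{\lambda''}$ of $\mathcal C$ with $p_{\lambda\lambda''}r=p_{\lambda\lambda'}$. It is *uniformly movable* if every $\lambda$ admits $\lambda'\ge\lambda$ and a family of morphisms $r_\mu:X_{\lambda'}\to X_\mu$ ($\mu\in\Lambda$) with $p_{\mu\nu}r_\nu=r_\mu$ for $\mu\le\nu$ (a morphism $X_{\lambda'}\to\mathbf X$ of pro-$\mathcal C$) such that $r_\lambda=p_{\lambda\lambda'}$. A pointed space is *movable* if it has an $HPol_*$-expansion whose inverse system is movable in $HTop_*$. For $k\ge1$ and a pointed space $(X,x)$, $\check\pi_k^{*^{top}}(X,x)=Sh^*((S^k,*),(X,x))$ is the set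 of pointed coarse shape morphisms, i.e. of classes of morphisms $\mathbf f^*=[(f,f^n_\lambda)]:(S^k,*)\to(\mathbf X,\mathbf x)$ of pro$^*$-$HPol_*$ into $HPol_*$-expansions $\mathbf p:(X,x)\to(\mathbf X,\mathbf x)$, where morphisms that correspond to each other under the canonical isomorphism of two expansions are identified. The group operation is $[(f^n_\lambda)]+[(g^n_\lambda)]=[(f^n_\lambda+g^n_\lambda)]$. The topology has the basis of sets $V_\lambda^{F^*}=\{G^*: p_\lambda\circ G^*=p_\lambda\circ F^*\}$. This is a topological group. For an $HPol_*$-expansion $\mathbf p$, let $\mathbf p_*$ denote the induced morphism from $Sh^*((S^k,*),(X,x))$ to the inverse system $\mathbf{Sh}^*((S^k,*),(X,x))=(Sh^*((S^k,*),(X_\lambda,x_\lambda)),(p_{\lambda\lambda'})_*,\Lambda)$. When movability or expansions of these groups as spaces are considered, the groups are pointed at their units. **Lemma.** Let $k\ge 1$. 1. Let $(\mathbf X,\mathbf x)=((X_\lambda,x_\lambda),p_{\lambda\lambda'},\Lambda)$ be an inverse system in $HTop_*$ whose terms admit $HPol_*$-expansions (so that $Sh^*$ of them is defined; every object of $HPol_*$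 is its own expansion). If $(\mathbf X,\mathbf x)$ is movable (respectively uniformly movable), then so is the inverse system $(Sh^*((S^k,*),(X_\lambda,x_\lambda)),(p_{\lambda\lambda'})_*,\Lambda)$ of topological groups and continuous homomorphisms. If all $(X_\lambda,x_\lambda)$ belong to $HPol_*$, these groups are discrete. 2. Let $(X,x)$ be a movable pointed space and $\mathbf p:(X,x)\to(\mathbf X,\mathbf x)$ an $HPol_*$-expansion of it. (a) If $\mathbf p_*:Sh^*((S^k,*),(X,x))\to\mathbf{Sh}^*((S^k,*),(X,x))$ is an $HPol_*$-expansion, then $\check\pi_k^{*^{top}}(X,x)$ is movable. (b) If $Sh^*((S^k,*),(X_\lambda,x_\lambda))$ is compact for all $\lambda\in\Lambda$, then $\mathbf p_*$ is an $HPol_*$-expansion, and $\check\pi_k^{*^{top}}(X,x)$ is movable. -/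

import Mathlib

open CategoryTheory

universe w w₁ w₂ w₃ v u

namespace CoarseShape

section Systems

/-- An inverse system in a category `C`, indexed by a (nonempty) directed preordered set. For
`a ≤ b` the bonding morphism `bond : obj b ⟶ obj a` is the one usually denoted `p_{ab}`. -/
structure InvSys (C : Type u) [Category.{v} C] where
  /-- the index set -/
  Idx : Type w
  [preorder : Preorder Idx]
  [directed : IsDirectedOrder Idx]
  [nonempty : Nonempty Idx]
  /-- the terms -/
  obj : Idx → C
  /-- the bonding morphisms -/
  bond : ∀ {a b : Idx}, a ≤ b → (obj b ⟶ obj a)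
  bond_refl : ∀ a : Idx, bond (le_refl a) = 𝟙 (obj a)
  bond_trans : ∀ {a b c : Idx} (hab : a ≤ b) (hbc : b ≤ c),
    bond hbc ≫ bond hab = bond (hab.trans hbc)

attribute [instance] InvSys.preorder InvSys.directed InvSys.nonempty

variable {C : Type u} [Category.{v} C]

/-- A rudimentary inverse system: a single object. -/
def rud (X : C) : InvSys.{w} C where
  Idx := PUnit
  obj _ := X
  bond _ := 𝟙 X
  bond_refl _ := rfl
  bond_trans _ _ := Category.comp_id _

/-- The image of an inverse system under a functor. -/
def InvSys.mapFunctor {D : Type*} [Category D] (F : C ⥤ D) (X : InvSys.{w} C) :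
    InvSys.{w} D where
  Idx := X.Idx
  obj a := F.obj (X.obj a)
  bond h := F.map (X.bond h)
  bond_refl a := by rw [X.bond_refl, F.map_id]
  bond_trans hab hbc := by rw [← F.map_comp, X.bond_trans]

/-- Movability: every `a` admits `b ≥ a` such that every `c ≥ a` admits `r : X_b ⟶ X_c` with
`p_{ac} ∘ r = p_{ab}`. -/
def InvSys.IsMovable (X : InvSys.{w} C) : Prop :=
  ∀ a : X.Idx, ∃ (b : X.Idx) (hab : a ≤ b), ∀ (c : X.Idx) (hac : a ≤ c),
    ∃ r : X.obj b ⟶ X.obj c, r ≫ X.bond hac = X.bond hab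

/-- Uniform movability: every `a` admits `b ≥ a` and a morphism `r` of pro-`C` from (the
rudimentary system) `X_b` to the system, i.e. a family `r_c : X_b ⟶ X_c` with
`p_{cd} ∘ r_d = r_c` for `c ≤ d`, such that `p_a ∘ r = p_{ab}`, where `p_a` is the canonical
morphism from the system to its term `X_a`. -/
def InvSys.IsUniformlyMovable (X : InvSys.{w} C) : Prop :=
  ∀ a : X.Idx, ∃ (b : X.Idx) (hab : a ≤ b) (r : ∀ c : X.Idx, X.obj b ⟶ X.obj c),
    (∀ {c d : X.Idx} (hcd : c ≤ d), r d ≫ X.bond hcd = r c) ∧ r a = X.bond hab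

/-- A morphism of inverse systems (a representative of a morphism of pro-`C`). -/
structure SMor (X : InvSys.{w₁} C) (Y : InvSys.{w₂} C) where
  /-- the index function -/
  idx : Y.Idx → X.Idx
  map : ∀ m : Y.Idx, X.obj (idx m) ⟶ Y.obj m
  comm : ∀ {m m' : Y.Idx} (h : m ≤ m'),
    ∃ (l : X.Idx) (h₁ : idx m ≤ l) (h₂ : idx m' ≤ l),
      X.bond h₂ ≫ map m' ≫ Y.bond h = X.bond h₁ ≫ map m

/-- An `S^*`-morphism of inverse systems. -/
structure SStarMor (X : InvSys.{w₁} C) (Y : InvSys.{w₂} C) where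
  /-- the index function -/
  idx : Y.Idx → X.Idx
  map : ℕ → ∀ m : Y.Idx, X.obj (idx m) ⟶ Y.obj m
  comm : ∀ {m m' : Y.Idx} (h : m ≤ m'),
    ∃ (l : X.Idx) (h₁ : idx m ≤ l) (h₂ : idx m' ≤ l) (n : ℕ), ∀ n' ≥ n,
      X.bond h₂ ≫ map n' m' ≫ Y.bond h = X.bond h₁ ≫ map n' m

variable {X : InvSys.{w₁} C} {Y : InvSys.{w₂} C} {Z : InvSys.{w₃} C}

lemma InvSys.bond_trans_assoc (X : InvSys.{w} C) {a b c : X.Idx} (hab : a ≤ b) (hbc : b ≤ c)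
    {K : C} (f : X.obj a ⟶ K) : X.bond hbc ≫ X.bond hab ≫ f = X.bond (hab.trans hbc) ≫ f := by
  rw [← Category.assoc, X.bond_trans]

/-- The equivalence relation on `S^*`-morphisms. -/
def SStarMor.Equiv (f g : SStarMor X Y) : Prop :=
  ∀ m : Y.Idx, ∃ (l : X.Idx) (h₁ : f.idx m ≤ l) (h₂ : g.idx m ≤ l) (n : ℕ), ∀ n' ≥ n,
    X.bond h₁ ≫ f.map n' m = X.bond h₂ ≫ g.map n' m

instance SStarMor.setoid (X : InvSys.{w₁} C) (Y : InvSys.{w₂} C) : Setoid (SStarMor X Y) where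
  r := SStarMor.Equiv
  iseqv :=
    { refl := fun f m => ⟨f.idx m, le_rfl, le_rfl, 0, fun _ _ => rfl⟩
      symm := fun h m => by
        obtain ⟨l, h₁, h₂, n, H⟩ := h m
        exact ⟨l, h₂, h₁, n, fun n' hn => (H n' hn).symm⟩
      trans := fun {f g k} h h' m => by
        obtain ⟨l, h₁, h₂, n, H⟩ := h m
        obtain ⟨l', h₁', h₂', n₂, H'⟩ := h' m
        obtain ⟨b, hb, hb'⟩ := exists_ge_ge l l'
        refine ⟨b, h₁.trans hb, h₂'.trans hb', max n n₂, fun n' hn => ?_⟩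
        rw [← X.bond_trans_assoc h₁ hb, H n' (le_trans (le_max_left _ _) hn),
          ← X.bond_trans_assoc h₂' hb', ← H' n' (le_trans (le_max_right _ _) hn),
          X.bond_trans_assoc, X.bond_trans_assoc] }

/-- The morphisms of the category pro`^*`-`C`. -/
def ProStar (X : InvSys.{w₁} C) (Y : InvSys.{w₂} C) := Quotient (SStarMor.setoid X Y)

/-- The identity `S^*`-morphism. -/
def SStarMor.id (X : InvSys.{w} C) : SStarMor X X where
  idx m := m
  map _ m := 𝟙 _
  comm {m m'} h := ⟨m', h, le_rfl, 0, fun _ _ => by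
    rw [X.bond_refl, Category.id_comp, Category.id_comp, Category.comp_id]⟩

/-- Composition of `S^*`-morphisms (in diagrammatic order). -/
def SStarMor.comp (f : SStarMor X Y) (g : SStarMor Y Z) : SStarMor X Z where
  idx m := f.idx (g.idx m)
  map n m := f.map n (g.idx m) ≫ g.map n m
  comm {m m'} h := by
    obtain ⟨μ, h₁, h₂, n, H⟩ := g.comm h
    obtain ⟨l₁, a₁, b₁, n₁, H₁⟩ := f.comm h₁
    obtain ⟨l₂, a₂, b₂, n₂, H₂⟩ := f.comm h₂
    obtain ⟨l, hl₁, hl₂⟩ := exists_ge_ge l₁ l₂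
    refine ⟨l, a₁.trans hl₁, a₂.trans hl₂, max n (max n₁ n₂), fun n' hn => ?_⟩
    have e := H n' (le_trans (le_max_left _ _) hn)
    have e₁ := H₁ n' (le_trans ((le_max_left _ _).trans (le_max_right _ _)) hn)
    have e₂ := H₂ n' (le_trans ((le_max_right _ _).trans (le_max_right _ _)) hn)
    calc X.bond (a₂.trans hl₂) ≫ (f.map n' (g.idx m') ≫ g.map n' m') ≫ Z.bond h
        = X.bond hl₂ ≫ (X.bond a₂ ≫ f.map n' (g.idx m')) ≫ g.map n' m' ≫ Z.bond h := by
          rw [← X.bond_trans a₂ hl₂]; simp only [Category.assoc]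
      _ = X.bond (b₂.trans hl₂) ≫ f.map n' μ ≫ Y.bond h₂ ≫ g.map n' m' ≫ Z.bond h := by
          rw [← e₂, ← X.bond_trans b₂ hl₂]; simp only [Category.assoc]
      _ = X.bond hl₁ ≫ (X.bond b₁ ≫ f.map n' μ ≫ Y.bond h₁) ≫ g.map n' m := by
          rw [e, ← X.bond_trans_assoc b₁ hl₁]
          simp only [Category.assoc]
      _ = X.bond (a₁.trans hl₁) ≫ f.map n' (g.idx m) ≫ g.map n' m := by
          rw [e₁, ← X.bond_trans a₁ hl₁]; simp only [Category.assoc]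

lemma SStarMor.comp_equiv {f f' : SStarMor X Y} {g g' : SStarMor Y Z} (hf : f.Equiv f')
    (hg : g.Equiv g') : (f.comp g).Equiv (f'.comp g') := by
  intro m
  obtain ⟨μ, h₁, h₂, n, H⟩ := hg m
  obtain ⟨l₁, a₁, b₁, n₁, H₁⟩ := f.comm h₁
  obtain ⟨l₂, a₂, b₂, n₂, H₂⟩ := f'.comm h₂
  obtain ⟨l₃, a₃, b₃, n₃, H₃⟩ := hf μ
  obtain ⟨l₀, hl₁, hl₂⟩ := exists_ge_ge l₁ l₂
  obtain ⟨l, hl₀, hl₃⟩ := exists_ge_ge l₀ l₃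
  replace hl₁ := hl₁.trans hl₀
  replace hl₂ := hl₂.trans hl₀
  refine ⟨l, a₁.trans hl₁, a₂.trans hl₂, max (max n n₁) (max n₂ n₃), fun n' hn => ?_⟩
  simp only [max_le_iff, ge_iff_le] at hn
  obtain ⟨⟨hn, hn₁⟩, hn₂, hn₃⟩ := hn
  have e := H n' hn
  have e₁ := H₁ n' hn₁
  have e₂ := H₂ n' hn₂
  have e₃ := H₃ n' hn₃
  calc X.bond (a₁.trans hl₁) ≫ f.map n' (g.idx m) ≫ g.map n' m
      = X.bond hl₁ ≫ (X.bond a₁ ≫ f.map n' (g.idx m)) ≫ g.map n' m := by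
        rw [← X.bond_trans a₁ hl₁]; simp only [Category.assoc]
    _ = X.bond (a₃.trans hl₃) ≫ f.map n' μ ≫ Y.bond h₁ ≫ g.map n' m := by
        rw [← e₁]; simp only [Category.assoc]; rw [X.bond_trans_assoc]
    _ = X.bond hl₃ ≫ (X.bond a₃ ≫ f.map n' μ) ≫ Y.bond h₂ ≫ g'.map n' m := by
        rw [e, ← X.bond_trans a₃ hl₃]; simp only [Category.assoc]
    _ = X.bond hl₂ ≫ (X.bond b₂ ≫ f'.map n' μ ≫ Y.bond h₂) ≫ g'.map n' m := by
        rw [e₃]; simp only [Category.assoc]; rw [X.bond_trans_assoc, X.bond_trans_assoc]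
    _ = X.bond (a₂.trans hl₂) ≫ f'.map n' (g'.idx m) ≫ g'.map n' m := by
        rw [e₂, ← X.bond_trans a₂ hl₂]; simp only [Category.assoc]

/-- Composition in pro`^*`-`C` (in diagrammatic order). -/
def ProStar.comp (f : ProStar X Y) (g : ProStar Y Z) : ProStar X Z :=
  Quotient.map₂ SStarMor.comp (fun _ _ hf _ _ hg => SStarMor.comp_equiv hf hg) f g

lemma ProStar.comp_assoc {W : InvSys.{w} C} (f : ProStar X Y) (g : ProStar Y Z)
    (h : ProStar Z W) : (f.comp g).comp h = f.comp (g.comp h) := by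
  induction f using Quotient.inductionOn
  induction g using Quotient.inductionOn
  induction h using Quotient.inductionOn
  refine Quotient.sound fun m => ⟨_, le_rfl, le_rfl, 0, fun n' _ => ?_⟩
  simp only [SStarMor.comp, Category.assoc]

/-- The functor from pro-`C` to pro`^*`-`C` on representatives. -/
def SMor.toStar (f : SMor X Y) : SStarMor X Y where
  idx := f.idx
  map _ := f.map
  comm h := by
    obtain ⟨l, h₁, h₂, H⟩ := f.comm h
    exact ⟨l, h₁, h₂, 0, fun _ _ => H⟩

/-- The morphism of pro`^*`-`C` induced by a morphism of inverse systems. -/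
def SMor.J (f : SMor X Y) : ProStar X Y := Quotient.mk _ f.toStar

/-- The identity morphism of inverse systems. -/
def SMor.id (X : InvSys.{w} C) : SMor X X where
  idx m := m
  map m := 𝟙 _
  comm {m m'} h := ⟨m', h, le_rfl, by
    rw [X.bond_refl, Category.id_comp, Category.id_comp, Category.comp_id]⟩

/-- Composition of morphisms of inverse systems. -/
def SMor.comp (f : SMor X Y) (g : SMor Y Z) : SMor X Z where
  idx m := f.idx (g.idx m)
  map m := f.map (g.idx m) ≫ g.map m
  comm h := by
    obtain ⟨l, h₁, h₂, n, H⟩ := (f.toStar.comp g.toStar).comm h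
    exact ⟨l, h₁, h₂, H n le_rfl⟩

lemma SMor.J_comp (f : SMor X Y) (g : SMor Y Z) : f.J.comp g.J = (f.comp g).J := rfl

lemma ProStar.comp_J_id (f : ProStar X Y) : f.comp (SMor.id Y).J = f := by
  induction f using Quotient.inductionOn
  refine Quotient.sound fun m => ⟨_, le_rfl, le_rfl, 0, fun n' _ => ?_⟩
  simp only [SStarMor.comp, SMor.toStar, SMor.id, Category.comp_id]

end Systems

section Expansions

variable {C : Type u} [Category.{v} C] (P : ObjectProperty C)

/-- `p : X ⟶ T` is a `P`-expansion of the object `X`. -/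
structure IsExpansion (X : C) (T : InvSys.{w} C) (p : ∀ l : T.Idx, X ⟶ T.obj l) : Prop where
  mem : ∀ l, P (T.obj l)
  comm : ∀ {a b : T.Idx} (h : a ≤ b), p b ≫ T.bond h = p a
  /-- condition (E1) -/
  factor : ∀ {K : C}, P K → ∀ h : X ⟶ K, ∃ (l : T.Idx) (f : T.obj l ⟶ K), p l ≫ f = h
  /-- condition (E2) -/
  eventually_eq : ∀ {K : C}, P K → ∀ {l : T.Idx} (f₀ f₁ : T.obj l ⟶ K),
    p l ≫ f₀ = p l ≫ f₁ → ∃ (l' : T.Idx) (h : l ≤ l'), T.bond h ≫ f₀ = T.bond h ≫ f₁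

/-- A `P`-expansion of the object `X`. -/
structure Expansion (X : C) where
  /-- the inverse system -/
  sys : InvSys.{w} C
  /-- the projections -/
  proj : ∀ l : sys.Idx, X ⟶ sys.obj l
  isExpansion : IsExpansion P X sys proj

/-- `X` admits a `P`-expansion, so that coarse shape morphisms with target `X` are defined. Every
object of `P` does, by `HasExpansion.of_mem` below, and every object of `C` does if `P` is dense
(pro-reflective) in `C`. -/
class HasExpansion (X : C) : Prop where
  nonempty : Nonempty (Expansion.{w} P X)

/-- An object is movable if it admits a `P`-expansion whose inverse system is movable. -/
def IsMovableObj (X : C) : Prop := ∃ p : Expansion.{w} P X, p.sys.IsMovable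

variable {P}

/-- An object of `P` is its own (rudimentary) expansion. -/
def Expansion.ofMem {K : C} (hK : P K) : Expansion.{w} P K where
  sys := rud K
  proj _ := 𝟙 K
  isExpansion :=
    { mem := fun _ => hK
      comm := fun _ => Category.comp_id _
      factor := fun _ h => ⟨PUnit.unit, h, Category.id_comp _⟩
      eventually_eq := fun _ l _ _ h => ⟨l, le_rfl, h⟩ }

lemma HasExpansion.of_mem {K : C} (hK : P K) : HasExpansion.{w} P K := ⟨⟨.ofMem hK⟩⟩

/-- A chosen expansion. -/
noncomputable def someExpansion (P : ObjectProperty C) (X : C) [h : HasExpansion.{w} P X] :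
    Expansion.{w} P X := h.nonempty.some

/-- `φ` satisfies `φ ∘ p = q ∘ f` in pro-`C`. -/
def IsLift {X Y : C} (p : Expansion.{w₁} P X) (q : Expansion.{w₂} P Y) (f : X ⟶ Y)
    (φ : SMor p.sys q.sys) : Prop :=
  ∀ m, p.proj (φ.idx m) ≫ φ.map m = f ≫ q.proj m

section
variable {X Y Z : C} (p : Expansion.{w₁} P X) (q : Expansion.{w₂} P Y) (r : Expansion.{w₃} P Z)

lemma exists_isLift (f : X ⟶ Y) : ∃ φ, IsLift p q f φ := by
  choose i φ hφ using fun m => p.isExpansion.factor (q.isExpansion.mem m) (f ≫ q.proj m)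
  refine ⟨⟨i, φ, fun {m m'} h => ?_⟩, hφ⟩
  obtain ⟨l, h₁, h₂⟩ := exists_ge_ge (i m) (i m')
  obtain ⟨l', hl, H⟩ := p.isExpansion.eventually_eq (q.isExpansion.mem m)
    (p.sys.bond h₂ ≫ φ m' ≫ q.sys.bond h) (p.sys.bond h₁ ≫ φ m) (by
      rw [← Category.assoc, p.isExpansion.comm, ← Category.assoc, hφ, Category.assoc,
        q.isExpansion.comm, ← Category.assoc (p.proj l), p.isExpansion.comm, hφ])
  refine ⟨l', h₁.trans hl, h₂.trans hl, ?_⟩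
  rwa [p.sys.bond_trans_assoc, p.sys.bond_trans_assoc] at H

variable {p q r}

lemma IsLift.unique {f : X ⟶ Y} {φ ψ : SMor p.sys q.sys} (hφ : IsLift p q f φ)
    (hψ : IsLift p q f ψ) : φ.J = ψ.J := by
  refine Quotient.sound fun m => ?_
  obtain ⟨l, h₁, h₂⟩ := exists_ge_ge (φ.idx m) (ψ.idx m)
  obtain ⟨l', hl, H⟩ := p.isExpansion.eventually_eq (q.isExpansion.mem m)
    (p.sys.bond h₁ ≫ φ.map m) (p.sys.bond h₂ ≫ ψ.map m) (by
      rw [← Category.assoc, p.isExpansion.comm, ← Category.assoc, p.isExpansion.comm, hφ, hψ])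
  refine ⟨l', h₁.trans hl, h₂.trans hl, 0, fun _ _ => ?_⟩
  rwa [p.sys.bond_trans_assoc, p.sys.bond_trans_assoc] at H

lemma IsLift.comp {f : X ⟶ Y} {g : Y ⟶ Z} {φ : SMor p.sys q.sys} {ψ : SMor q.sys r.sys}
    (hφ : IsLift p q f φ) (hψ : IsLift q r g ψ) : IsLift p r (f ≫ g) (φ.comp ψ) := fun m => by
  rw [Category.assoc, ← hψ m, ← Category.assoc, ← hφ, Category.assoc]; rfl

lemma IsLift.comp' {f : X ⟶ Y} {g : Y ⟶ Z} {k : X ⟶ Z} {φ : SMor p.sys q.sys}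
    {ψ : SMor q.sys r.sys} {χ : SMor p.sys r.sys}
    (hφ : IsLift p q f φ) (hψ : IsLift q r g ψ) (hχ : IsLift p r k χ) (hk : f ≫ g = k) :
    φ.J.comp ψ.J = χ.J := by
  subst hk
  rw [SMor.J_comp]; exact (hφ.comp hψ).unique hχ

lemma IsLift.id : IsLift p p (𝟙 X) (SMor.id p.sys) := fun m => by
  rw [Category.id_comp]; exact Category.comp_id _

end

/-- The morphism `f` on the level of expansions. -/
noncomputable def lift {X Y : C} (p : Expansion.{w₁} P X) (q : Expansion.{w₂} P Y) (f : X ⟶ Y) :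
    SMor p.sys q.sys := (exists_isLift p q f).choose

lemma isLift_lift {X Y : C} (p : Expansion.{w₁} P X) (q : Expansion.{w₂} P Y) (f : X ⟶ Y) :
    IsLift p q f (lift p q f) := (exists_isLift p q f).choose_spec

end Expansions

section Sh

variable {C : Type u} [Category.{v} C] (P : ObjectProperty C)

/-- A representative of a coarse shape morphism from `S` to `Y`, where `S` is an object of `P`,
regarded as its own rudimentary expansion: an expansion of `Y` and a morphism of
pro`^*`-`C` from `(S)` to its inverse system. -/
structure Rep (S Y : C) where
  /-- an expansion of the target -/
  exp : Expansion.{w} P Y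
  /-- a morphism of pro`^*`-`C` -/
  hom : ProStar (rud.{w} S) exp.sys

/-- Two representatives `f` and `f'` are equivalent if `f' = J(j) ∘ f` for
the canonical (unique) isomorphism `j` of pro-`C` which is compatible with the two
expansions of `Y`. -/
def Rep.Rel {S Y : C} (r r' : Rep.{w} P S Y) : Prop :=
  ∃ j : SMor r.exp.sys r'.exp.sys, IsLift r.exp r'.exp (𝟙 Y) j ∧ r.hom.comp j.J = r'.hom

/-- `Sh^*(S, Y)`: the set of coarse shape morphisms from an object `S` of `P` to `Y`. -/
def Sh (S Y : C) := Quot (Rep.Rel.{w} P (S := S) (Y := Y))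

variable {P} {S X Y Z : C}

/-- The coarse shape morphism represented by `f`. -/
def Sh.mk (q : Expansion.{w} P Y) (f : ProStar (rud.{w} S) q.sys) : Sh.{w} P S Y :=
  Quot.mk _ ⟨q, f⟩

/-- The representative of a coarse shape morphism with respect to a given expansion. -/
noncomputable def Sh.rep (q : Expansion.{w} P Y) : Sh.{w} P S Y → ProStar (rud.{w} S) q.sys :=
  Quot.lift (fun r => r.hom.comp (lift r.exp q (𝟙 Y)).J) (by
    rintro r r' ⟨j, hj, h⟩
    rw [← h, ProStar.comp_assoc,
      hj.comp' (isLift_lift _ _ _) (isLift_lift _ _ _) (Category.comp_id _)])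

/-- Coarse shape morphisms correspond to the morphisms of pro`^*`-`C` into the inverse system of
any given expansion. -/
noncomputable def Sh.repEquiv (q : Expansion.{w} P Y) :
    Sh.{w} P S Y ≃ ProStar (rud.{w} S) q.sys where
  toFun := Sh.rep q
  invFun := Sh.mk q
  left_inv F := by
    induction F using Quot.inductionOn with | _ r => ?_
    exact (Quot.sound ⟨lift r.exp q (𝟙 Y), isLift_lift _ _ _, rfl⟩).symm
  right_inv f := by
    change f.comp (lift q q (𝟙 Y)).J = f
    rw [(isLift_lift q q (𝟙 Y)).unique IsLift.id, ProStar.comp_J_id]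

lemma Sh.mk_rep (q : Expansion.{w} P Y) (F : Sh.{w} P S Y) : Sh.mk q (Sh.rep q F) = F :=
  (Sh.repEquiv q).left_inv F

lemma Sh.rep_mk (q : Expansion.{w} P Y) (f : ProStar (rud.{w} S) q.sys) :
    Sh.rep q (Sh.mk q f) = f :=
  (Sh.repEquiv q).right_inv f

lemma Sh.mk_eq_mk {q q' : Expansion.{w} P Y} (j : SMor q.sys q'.sys) (hj : IsLift q q' (𝟙 Y) j)
    (f : ProStar (rud.{w} S) q.sys) : Sh.mk q f = Sh.mk q' (f.comp j.J) :=
  Quot.sound ⟨j, hj, rfl⟩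

/-- Composition `F ↦ f ∘ F` of coarse shape morphisms with (the coarse shape morphism induced by)
a morphism `f : Y ⟶ Z` of `C`. -/
noncomputable def Sh.map (f : Y ⟶ Z) [HasExpansion.{w} P Z] (F : Sh.{w} P S Y) : Sh.{w} P S Z :=
  Quot.lift (fun r : Rep.{w} P S Y =>
      Sh.mk (someExpansion.{w} P Z) (r.hom.comp (lift r.exp (someExpansion.{w} P Z) f).J)) (by
    rintro r r' ⟨j, hj, h⟩
    rw [← h, ProStar.comp_assoc,
      hj.comp' (isLift_lift _ _ _) (isLift_lift _ _ _) (Category.id_comp _)]) F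

lemma Sh.map_mk (f : Y ⟶ Z) [HasExpansion.{w} P Z] (q : Expansion.{w} P Y)
    (q' : Expansion.{w} P Z) {φ : SMor q.sys q'.sys} (hφ : IsLift q q' f φ)
    (g : ProStar (rud.{w} S) q.sys) : Sh.map f (Sh.mk q g) = Sh.mk q' (g.comp φ.J) := by
  change Sh.mk (someExpansion.{w} P Z) (g.comp (lift q (someExpansion.{w} P Z) f).J) = _
  rw [Sh.mk_eq_mk _ (isLift_lift (someExpansion.{w} P Z) q' (𝟙 Z)), ProStar.comp_assoc,
    (isLift_lift _ _ _).comp' (isLift_lift _ _ _) hφ (Category.comp_id _)]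

lemma Sh.map_id [HasExpansion.{w} P Y] (F : Sh.{w} P S Y) : Sh.map (𝟙 Y) F = F := by
  induction F using Quot.inductionOn with | _ r => ?_
  refine (Sh.map_mk (𝟙 Y) r.exp r.exp IsLift.id r.hom).trans ?_
  rw [ProStar.comp_J_id]; rfl

lemma Sh.map_comp (f : X ⟶ Y) (g : Y ⟶ Z) [HasExpansion.{w} P Y] [HasExpansion.{w} P Z]
    (F : Sh.{w} P S X) : Sh.map (f ≫ g) F = Sh.map g (Sh.map f F) := by
  induction F using Quot.inductionOn with | _ r => ?_
  have h₁ := isLift_lift r.exp (someExpansion.{w} P Y) f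
  have h₂ := isLift_lift (someExpansion.{w} P Y) (someExpansion.{w} P Z) g
  change Sh.map (f ≫ g) (Sh.mk r.exp r.hom) = Sh.map g (Sh.map f (Sh.mk r.exp r.hom))
  rw [Sh.map_mk f _ _ h₁, Sh.map_mk g _ _ h₂, Sh.map_mk (f ≫ g) _ _ (h₁.comp h₂),
    ProStar.comp_assoc, SMor.J_comp]

/-- The basic set `V_l^F = {G | p_l ∘ G = p_l ∘ F}` of an expansion of `Y`. -/
def Sh.basicSet (q : Expansion.{w} P Y) (l : q.sys.Idx) (F : Sh.{w} P S Y) : Set (Sh.{w} P S Y) :=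
  haveI : HasExpansion.{w} P (q.sys.obj l) := .of_mem (q.isExpansion.mem l)
  {G | Sh.map (q.proj l) G = Sh.map (q.proj l) F}

/-- The topology of `Sh^*(S, Y)`. By `Sh.isTopologicalBasis` below, the sets `V_l^F` of any single
expansion of `Y` form a basis of it. -/
instance Sh.topology : TopologicalSpace (Sh.{w} P S Y) :=
  .generateFrom {U | ∃ (q : Expansion.{w} P Y) (l : q.sys.Idx) (F : Sh.{w} P S Y),
    U = Sh.basicSet q l F}

lemma Sh.continuous_map (f : Y ⟶ Z) [HasExpansion.{w} P Z] :
    Continuous (Sh.map f : Sh.{w} P S Y → Sh.{w} P S Z) := by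
  refine continuous_generateFrom_iff.2 ?_
  rintro _ ⟨q', m, F', rfl⟩
  have : HasExpansion.{w} P (q'.sys.obj m) := .of_mem (q'.isExpansion.mem m)
  refine isOpen_iff_forall_mem_open.2 fun G hG => ?_
  have hG' : Sh.map (q'.proj m) (Sh.map f G) = Sh.map (q'.proj m) F' := hG
  obtain ⟨r, hr⟩ := Quot.exists_rep G
  obtain ⟨l, g, hg⟩ := r.exp.isExpansion.factor (q'.isExpansion.mem m) (f ≫ q'.proj m)
  have : HasExpansion.{w} P (r.exp.sys.obj l) := .of_mem (r.exp.isExpansion.mem l)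
  refine ⟨Sh.basicSet r.exp l G, fun H hH => ?_, .basic _ ⟨r.exp, l, G, rfl⟩, rfl⟩
  have hH' : Sh.map (r.exp.proj l) H = Sh.map (r.exp.proj l) G := hH
  change Sh.map (q'.proj m) (Sh.map f H) = Sh.map (q'.proj m) F'
  rw [← hG', ← Sh.map_comp, ← Sh.map_comp, ← hg, Sh.map_comp, hH', ← Sh.map_comp]

lemma Sh.discreteTopology (hY : P Y) : DiscreteTopology (Sh.{w} P S Y) := by
  refine discreteTopology_iff_isOpen_singleton.2 fun F => ?_
  have : HasExpansion.{w} P Y := .of_mem hY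
  refine .basic _ ⟨.ofMem hY, PUnit.unit, F, ?_⟩
  ext G
  change G = F ↔ Sh.map (𝟙 Y) G = Sh.map (𝟙 Y) F
  rw [Sh.map_id, Sh.map_id]

lemma Sh.isTopologicalBasis (q : Expansion.{w} P Y) :
    TopologicalSpace.IsTopologicalBasis
      {U | ∃ (l : q.sys.Idx) (F : Sh.{w} P S Y), U = Sh.basicSet q l F} := by
  refine TopologicalSpace.isTopologicalBasis_of_isOpen_of_nhds ?_ ?_
  · rintro _ ⟨l, F, rfl⟩; exact .basic _ ⟨q, l, F, rfl⟩
  intro G U hG hU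
  suffices ∀ U : Set (Sh.{w} P S Y), IsOpen U → G ∈ U → ∃ l, Sh.basicSet q l G ⊆ U by
    obtain ⟨l, hl⟩ := this U hU hG
    exact ⟨_, ⟨l, G, rfl⟩, rfl, hl⟩
  clear hG hU U
  intro U hU
  have key : ∀ {l l' : q.sys.Idx}, l ≤ l' → Sh.basicSet q l' G ⊆ Sh.basicSet q l G := by
    intro l l' h H hH
    have : HasExpansion.{w} P (q.sys.obj l) := .of_mem (q.isExpansion.mem l)
    have : HasExpansion.{w} P (q.sys.obj l') := .of_mem (q.isExpansion.mem l')
    change Sh.map (q.proj l) H = Sh.map (q.proj l) G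
    replace hH : Sh.map (q.proj l') H = Sh.map (q.proj l') G := hH
    rw [← q.isExpansion.comm h, Sh.map_comp, hH, ← Sh.map_comp]
  induction hU with
  | basic s hs =>
    obtain ⟨q', m, F, rfl⟩ := hs
    intro hG
    have : HasExpansion.{w} P (q'.sys.obj m) := .of_mem (q'.isExpansion.mem m)
    obtain ⟨l, g, hg⟩ := q.isExpansion.factor (q'.isExpansion.mem m) (q'.proj m)
    have : HasExpansion.{w} P (q.sys.obj l) := .of_mem (q.isExpansion.mem l)
    refine ⟨l, fun H hH => ?_⟩
    replace hG : Sh.map (q'.proj m) G = Sh.map (q'.proj m) F := hG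
    replace hH : Sh.map (q.proj l) H = Sh.map (q.proj l) G := hH
    change Sh.map (q'.proj m) H = Sh.map (q'.proj m) F
    rw [← hG, ← hg, Sh.map_comp, hH, ← Sh.map_comp]
  | univ => exact fun _ => ⟨Classical.arbitrary _, Set.subset_univ _⟩
  | inter s t _ _ hs ht =>
    rintro ⟨h₁, h₂⟩
    obtain ⟨l₁, hl₁⟩ := hs h₁
    obtain ⟨l₂, hl₂⟩ := ht h₂
    obtain ⟨l, a, b⟩ := exists_ge_ge l₁ l₂
    exact ⟨l, Set.subset_inter ((key a).trans hl₁) ((key b).trans hl₂)⟩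
  | sUnion T _ ih =>
    rintro ⟨s, hs, hG⟩
    obtain ⟨l, hl⟩ := ih s hs hG
    exact ⟨l, hl.trans (Set.subset_sUnion_of_mem hs)⟩

variable {T T' : InvSys.{w} C}

/-- The `S^*`-morphism from the rudimentary system `(S)` given by terms `t n m : S ⟶ T_m`. -/
def SStarMor.ofRud (t : ℕ → ∀ m : T.Idx, S ⟶ T.obj m)
    (ht : ∀ {m m' : T.Idx} (h : m ≤ m'), ∃ n, ∀ n' ≥ n, t n' m' ≫ T.bond h = t n' m) :
    SStarMor (rud.{w} S) T where
  idx _ := PUnit.unit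
  map := t
  comm {m m'} h := by
    obtain ⟨n, H⟩ := ht h
    refine ⟨PUnit.unit, le_rfl, le_rfl, n, fun n' hn => ?_⟩
    exact (Category.id_comp _).trans ((H n' hn).trans (Category.id_comp _).symm)

lemma SStarMor.term_comm (f : SStarMor (rud.{w} S) T) {m m' : T.Idx} (h : m ≤ m') :
    ∃ n, ∀ n' ≥ n, (show S ⟶ T.obj m' from f.map n' m') ≫ T.bond h = f.map n' m := by
  obtain ⟨l, h₁, h₂, n, H⟩ := f.comm h
  refine ⟨n, fun n' hn => ?_⟩
  exact (Category.id_comp _).symm.trans ((H n' hn).trans (Category.id_comp _))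

lemma SStarMor.term_equiv {f g : SStarMor (rud.{w} S) T} (h : f.Equiv g) (m : T.Idx) :
    ∃ n, ∀ n' ≥ n, (show S ⟶ T.obj m from f.map n' m) = g.map n' m := by
  obtain ⟨l, h₁, h₂, n, H⟩ := h m
  refine ⟨n, fun n' hn => ?_⟩
  exact (Category.id_comp _).symm.trans ((H n' hn).trans (Category.id_comp _))

lemma SStarMor.equiv_of_term {f g : SStarMor (rud.{w} S) T}
    (h : ∀ m, ∃ n, ∀ n' ≥ n, (show S ⟶ T.obj m from f.map n' m) = g.map n' m) : f.Equiv g := by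
  intro m
  obtain ⟨n, H⟩ := h m
  refine ⟨PUnit.unit, le_rfl, le_rfl, n, fun n' hn => ?_⟩
  exact (Category.id_comp _).trans ((H n' hn).trans (Category.id_comp _).symm)

/-- A natural group structure on the sets of morphisms out of `S`. -/
class Cogroup (S : C) where
  [group : ∀ K : C, Group (S ⟶ K)]
  mul_comp : ∀ {K L : C} (f g : S ⟶ K) (h : K ⟶ L), (f * g) ≫ h = (f ≫ h) * (g ≫ h)

attribute [instance, reducible] Cogroup.group

section Group

variable [Cogroup S]

lemma Cogroup.one_comp {K L : C} (h : K ⟶ L) : (1 : S ⟶ K) ≫ h = 1 :=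
  (MonoidHom.mk' (fun f : S ⟶ K => f ≫ h) fun f g => Cogroup.mul_comp f g h).map_one

lemma Cogroup.inv_comp {K L : C} (f : S ⟶ K) (h : K ⟶ L) : f⁻¹ ≫ h = (f ≫ h)⁻¹ :=
  (MonoidHom.mk' (fun f : S ⟶ K => f ≫ h) fun f g => Cogroup.mul_comp f g h).map_inv f


/-- Termwise product: `(f, f_m^n) + (g, g_m^n) = (f_m^n + g_m^n)`. -/
def SStarMor.mul (f g : SStarMor (rud.{w} S) T) : SStarMor (rud.{w} S) T :=
  .ofRud (fun n m => (show S ⟶ T.obj m from f.map n m) * (show S ⟶ T.obj m from g.map n m))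
    fun h => by
      obtain ⟨n₁, h₁⟩ := f.term_comm h
      obtain ⟨n₂, h₂⟩ := g.term_comm h
      refine ⟨max n₁ n₂, fun n' hn => ?_⟩
      rw [Cogroup.mul_comp, h₁ n' (le_trans (le_max_left _ _) hn),
        h₂ n' (le_trans (le_max_right _ _) hn)]

/-- The termwise inverse. -/
def SStarMor.inv (f : SStarMor (rud.{w} S) T) : SStarMor (rud.{w} S) T :=
  .ofRud (fun n m => (show S ⟶ T.obj m from f.map n m)⁻¹) fun h => by
    obtain ⟨n₁, h₁⟩ := f.term_comm h
    exact ⟨n₁, fun n' hn => by rw [Cogroup.inv_comp, h₁ n' hn]⟩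

/-- The trivial morphism. -/
def SStarMor.one (S : C) [Cogroup S] (T : InvSys.{w} C) : SStarMor (rud.{w} S) T :=
  .ofRud (fun _ _ => 1) fun _ => ⟨0, fun _ _ => Cogroup.one_comp _⟩

instance ProStar.instMul : Mul (ProStar (rud.{w} S) T) where
  mul := Quotient.map₂ SStarMor.mul fun _ _ hf _ _ hg => SStarMor.equiv_of_term fun m => by
    obtain ⟨n₁, h₁⟩ := SStarMor.term_equiv hf m
    obtain ⟨n₂, h₂⟩ := SStarMor.term_equiv hg m
    exact ⟨max n₁ n₂, fun n' hn => congrArg₂ (· * ·) (h₁ n' (le_trans (le_max_left _ _) hn))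
      (h₂ n' (le_trans (le_max_right _ _) hn))⟩

instance ProStar.instInv : Inv (ProStar (rud.{w} S) T) where
  inv := Quotient.map SStarMor.inv fun _ _ hf => SStarMor.equiv_of_term fun m => by
    obtain ⟨n₁, h₁⟩ := SStarMor.term_equiv hf m
    exact ⟨n₁, fun n' hn => congrArg (·⁻¹) (h₁ n' hn)⟩

instance ProStar.instOne : One (ProStar (rud.{w} S) T) where
  one := Quotient.mk _ (SStarMor.one S T)

/-- The group of morphisms of pro`^*`-`C` from `(S)` to an inverse system. -/
instance ProStar.instGroup : Group (ProStar (rud.{w} S) T) :=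
  Group.ofLeftAxioms
    (fun a b c => by
      induction a using Quotient.inductionOn
      induction b using Quotient.inductionOn
      induction c using Quotient.inductionOn
      exact Quotient.sound <| SStarMor.equiv_of_term fun m => ⟨0, fun _ _ => mul_assoc _ _ _⟩)
    (fun a => by
      induction a using Quotient.inductionOn
      exact Quotient.sound <| SStarMor.equiv_of_term fun m => ⟨0, fun _ _ => one_mul _⟩)
    (fun a => by
      induction a using Quotient.inductionOn
      exact Quotient.sound <| SStarMor.equiv_of_term fun m => ⟨0, fun _ _ => inv_mul_cancel _⟩)

lemma ProStar.mul_comp (f g : ProStar (rud.{w} S) T) (h : ProStar T T') :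
    (f * g).comp h = f.comp h * g.comp h := by
  induction f using Quotient.inductionOn
  induction g using Quotient.inductionOn
  induction h using Quotient.inductionOn
  exact Quotient.sound <| SStarMor.equiv_of_term fun m => ⟨0, fun n' _ =>
    Cogroup.mul_comp (S := S) _ _ _⟩

/-- The group structure of `Sh^*(S, Y)`. By `Sh.mk_mul` below, the product is computed on
representatives with respect to any expansion of `Y`. -/
noncomputable instance Sh.instGroup [HasExpansion.{w} P Y] : Group (Sh.{w} P S Y) :=
  (Sh.repEquiv (someExpansion.{w} P Y)).group

lemma Sh.mk_mul [HasExpansion.{w} P Y] (q : Expansion.{w} P Y)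
    (f g : ProStar (rud.{w} S) q.sys) :
    (Sh.mk q (f * g) : Sh.{w} P S Y) = Sh.mk q f * Sh.mk q g := by
  have h := isLift_lift q (someExpansion.{w} P Y) (𝟙 Y)
  have key : (Sh.mk (someExpansion.{w} P Y) (f.comp (lift q (someExpansion.{w} P Y) (𝟙 Y)).J *
      g.comp (lift q (someExpansion.{w} P Y) (𝟙 Y)).J) : Sh.{w} P S Y) =
      Sh.mk (someExpansion.{w} P Y) (f.comp (lift q (someExpansion.{w} P Y) (𝟙 Y)).J) *
      Sh.mk (someExpansion.{w} P Y) (g.comp (lift q (someExpansion.{w} P Y) (𝟙 Y)).J) :=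
    ((Sh.repEquiv (someExpansion.{w} P Y)).mulEquiv.symm.map_mul _ _)
  rw [Sh.mk_eq_mk _ h, Sh.mk_eq_mk _ h f, Sh.mk_eq_mk _ h g, ProStar.mul_comp, key]

/-- Composition with `f : Y ⟶ Z`, as a continuous homomorphism. -/
noncomputable def Sh.mapHom (S : C) [Cogroup S] (f : Y ⟶ Z) [HasExpansion.{w} P Y]
    [HasExpansion.{w} P Z] : Sh.{w} P S Y →ₜ* Sh.{w} P S Z where
  toMonoidHom := MonoidHom.mk' (Sh.map f) fun F G => by
    have q := someExpansion.{w} P Y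
    have q' := someExpansion.{w} P Z
    rw [← Sh.mk_rep q F, ← Sh.mk_rep q G, ← Sh.mk_mul,
      Sh.map_mk f q q' (isLift_lift q q' f), Sh.map_mk f q q' (isLift_lift q q' f),
      Sh.map_mk f q q' (isLift_lift q q' f), ProStar.mul_comp, Sh.mk_mul]
  continuous_toFun := Sh.continuous_map f

instance Sh.isTopologicalGroup [HasExpansion.{w} P Y] : IsTopologicalGroup (Sh.{w} P S Y) := by
  have hnhds : ∀ (F : Sh.{w} P S Y) (U : Set (Sh.{w} P S Y)), IsOpen U → F ∈ U →
      ∃ l, Sh.basicSet (someExpansion.{w} P Y) l F ⊆ U := by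
    intro F U hU hF
    obtain ⟨_, ⟨l, F', rfl⟩, hF', hs⟩ :=
      (Sh.isTopologicalBasis (someExpansion.{w} P Y)).exists_subset_of_mem_open hF hU
    have : HasExpansion.{w} P ((someExpansion.{w} P Y).sys.obj l) :=
      .of_mem ((someExpansion.{w} P Y).isExpansion.mem l)
    refine ⟨l, fun G hG => hs ?_⟩
    exact Eq.trans (show Sh.map _ G = Sh.map _ F from hG) hF'
  have hopen : ∀ (F : Sh.{w} P S Y) l, IsOpen (Sh.basicSet (someExpansion.{w} P Y) l F) :=
    fun F l => .basic _ ⟨_, l, F, rfl⟩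
  refine { continuous_mul := ?_, continuous_inv := ?_ }
  · refine continuous_iff_continuousAt.2 fun ⟨F, G⟩ => ?_
    refine (nhds_basis_opens _).tendsto_right_iff.2 ?_
    rintro U ⟨hFG, hU⟩
    obtain ⟨l, hl⟩ := hnhds _ U hU hFG
    filter_upwards [((hopen F l).prod (hopen G l)).mem_nhds ⟨rfl, rfl⟩]
    rintro ⟨F', G'⟩ ⟨hF, hG⟩
    refine hl ?_
    have : HasExpansion.{w} P ((someExpansion.{w} P Y).sys.obj l) :=
      .of_mem ((someExpansion.{w} P Y).isExpansion.mem l)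
    have a := (Sh.mapHom S ((someExpansion.{w} P Y).proj l)).map_mul F' G'
    have b := (Sh.mapHom S ((someExpansion.{w} P Y).proj l)).map_mul F G
    exact a.trans ((congrArg₂ (· * ·) hF hG).trans b.symm)
  · refine continuous_iff_continuousAt.2 fun F => ?_
    refine (nhds_basis_opens _).tendsto_right_iff.2 ?_
    rintro U ⟨hF, hU⟩
    obtain ⟨l, hl⟩ := hnhds _ U hU hF
    filter_upwards [(hopen F l).mem_nhds rfl] with F' hF'
    refine hl ?_
    have : HasExpansion.{w} P ((someExpansion.{w} P Y).sys.obj l) :=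
      .of_mem ((someExpansion.{w} P Y).isExpansion.mem l)
    have a := map_inv (Sh.mapHom S ((someExpansion.{w} P Y).proj l)) F'
    have b := map_inv (Sh.mapHom S ((someExpansion.{w} P Y).proj l)) F
    exact a.trans ((congrArg (·⁻¹) hF').trans b.symm)

end Group

end Sh

/-- The category of topological groups and continuous homomorphisms. -/
structure TopGrp where
  carrier : Type u
  [group : Group carrier]
  [topology : TopologicalSpace carrier]
  [isTopologicalGroup : IsTopologicalGroup carrier]

attribute [instance] TopGrp.group TopGrp.topology TopGrp.isTopologicalGroup

instance : Category TopGrp.{u} where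
  Hom G H := G.carrier →ₜ* H.carrier
  id G := ContinuousMonoidHom.id G.carrier
  comp f g := ContinuousMonoidHom.comp g f

section ShSystem

variable {C : Type u} [Category.{v} C] (P : ObjectProperty C) (S : C) [Cogroup S]

/-- The topological group `Sh^*(S, Y)`. -/
noncomputable def shGrp (Y : C) [HasExpansion.{w} P Y] : TopGrp where
  carrier := Sh.{w} P S Y

/-- The continuous homomorphism `Sh^*(S, Y) ⟶ Sh^*(S, Z)` induced by `f : Y ⟶ Z`. -/
noncomputable def shGrpMap {Y Z : C} (f : Y ⟶ Z) [HasExpansion.{w} P Y] [HasExpansion.{w} P Z] :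
    shGrp.{w} P S Y ⟶ shGrp.{w} P S Z := Sh.mapHom S f

/-- The inverse system of the topological groups `Sh^*(S, T_a)`, with the induced bonding
homomorphisms. -/
noncomputable def shSys (T : InvSys.{w₁} C) [∀ a, HasExpansion.{w} P (T.obj a)] :
    InvSys.{w₁} TopGrp where
  Idx := T.Idx
  obj a := shGrp.{w} P S (T.obj a)
  bond h := shGrpMap.{w} P S (T.bond h)
  bond_refl a := ContinuousMonoidHom.ext fun F =>
    (congrArg (fun g => Sh.map g (show Sh.{w} P S (T.obj a) from F)) (T.bond_refl a)).trans
      (Sh.map_id _)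
  bond_trans {_ _ c} hab hbc := ContinuousMonoidHom.ext fun F =>
    (Sh.map_comp (T.bond hbc) (T.bond hab) (show Sh.{w} P S (T.obj c) from F)).symm.trans
      (congrArg (fun g => Sh.map g (show Sh.{w} P S (T.obj c) from F)) (T.bond_trans hab hbc))

end ShSystem

section Pointed

/-- A pointed topological space. -/
structure PtdTop where
  carrier : Type u
  [topology : TopologicalSpace carrier]
  pt : carrier

attribute [instance] PtdTop.topology

/-- Pointed maps. -/
def PtdMap (X Y : PtdTop.{u}) := {f : C(X.carrier, Y.carrier) // f X.pt = Y.pt}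

/-- Two pointed maps are equivalent if they are homotopic relative to the base point. -/
instance PtdMap.setoid (X Y : PtdTop.{u}) : Setoid (PtdMap X Y) where
  r f g := f.1.HomotopicRel g.1 {X.pt}
  iseqv :=
    { refl := fun f => .refl f.1
      symm := fun h => h.symm
      trans := fun h h' => h.trans h' }

/-- The composite of pointed maps. -/
def PtdMap.comp {X Y Z : PtdTop.{u}} (f : PtdMap X Y) (g : PtdMap Y Z) : PtdMap X Z :=
  ⟨g.1.comp f.1, (congrArg g.1 f.2).trans g.2⟩

lemma PtdMap.comp_homotopic {X Y Z : PtdTop.{u}} {f f' : PtdMap X Y} {g g' : PtdMap Y Z}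
    (hf : f ≈ f') (hg : g ≈ g') : f.comp g ≈ f'.comp g' := by
  refine Setoid.trans (b := f'.comp g) (hf.map fun F => F.compContinuousMap g.1) ?_
  refine hg.map fun G => ⟨⟨⟨fun x => G (x.1, f'.1 x.2), by fun_prop⟩, ?_, ?_⟩, ?_⟩
  · intro x; exact G.apply_zero _
  · intro x; exact G.apply_one _
  · rintro t x rfl
    exact G.eq_fst t f'.2

/-- The pointed homotopy category `HTop_*`: pointed spaces and pointed homotopy classes of pointed
maps. -/
instance : Category PtdTop.{u} where
  Hom X Y := Quotient (PtdMap.setoid X Y)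
  id X := Quotient.mk _ ⟨.id _, rfl⟩
  comp f g := Quotient.map₂ PtdMap.comp (fun _ _ hf _ _ hg => PtdMap.comp_homotopic hf hg) f g
  id_comp f := by induction f using Quotient.inductionOn; rfl
  comp_id f := by induction f using Quotient.inductionOn; rfl
  assoc f g h := by
    induction f using Quotient.inductionOn
    induction g using Quotient.inductionOn
    induction h using Quotient.inductionOn
    rfl

/-- The pointed homotopy class of a pointed map. -/
def PtdMap.hclass {X Y : PtdTop.{u}} (f : PtdMap X Y) : X ⟶ Y := Quotient.mk _ f

/-- A topological group as a space pointed at its unit, and a continuous homomorphism as a pointed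
homotopy class. -/
def TopGrp.toPtd : TopGrp.{u} ⥤ PtdTop.{u} where
  obj G := { carrier := G.carrier, pt := 1 }
  map {G H} f := PtdMap.hclass
    ⟨⟨fun x => (show G.carrier →ₜ* H.carrier from f) x,
      (show G.carrier →ₜ* H.carrier from f).continuous_toFun⟩,
      map_one (show G.carrier →ₜ* H.carrier from f)⟩
  map_id _ := rfl
  map_comp _ _ := rfl

end Pointed

section Polyhedra

variable {V : Type u} (K : AbstractSimplicialComplex V)

/-- The set of points of the geometric realization `|K|` of a simplicial complex: barycentric
coordinates whose support is a simplex of `K`. -/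
def Realization : Type u :=
  {t : V →₀ ℝ // (∀ v, 0 ≤ t v) ∧ (t.sum fun _ a => a) = 1 ∧ t.support ∈ K.faces}

/-- The inclusion of the closed simplex spanned by `s`, with the barycentric coordinates taken from
the standard (Euclidean) simplex. -/
noncomputable def Realization.ofFace (s : Finset V) (hs : s ∈ K.faces) (t : stdSimplex ℝ s) :
    Realization K :=
  ⟨Finsupp.embDomain (Function.Embedding.subtype (· ∈ s)) (Finsupp.equivFunOnFinite.symm t.1), by
    refine ⟨fun v => ?_, ?_, ?_⟩
    · by_cases hv : v ∈ s
      · exact (t.2.1 ⟨v, hv⟩).trans_eq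
          (Finsupp.embDomain_apply_self (Function.Embedding.subtype (· ∈ s))
            (Finsupp.equivFunOnFinite.symm t.1) ⟨v, hv⟩).symm
      · rw [Finsupp.embDomain_of_notMem_range]
        rintro ⟨w, rfl⟩
        exact hv w.2
    · rw [Finsupp.sum_embDomain, Finsupp.sum_fintype _ _ fun _ => rfl]
      exact t.2.2
    · refine (K.isRelLowerSet_faces hs).2 ?_ ?_
      · intro v hv
        rw [Finsupp.support_embDomain] at hv
        obtain ⟨w, -, rfl⟩ := Finset.mem_map.1 hv
        exact w.2
      · rw [Finsupp.support_embDomain, Finset.map_nonempty, Finset.nonempty_iff_ne_empty,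
          Ne, Finsupp.support_eq_empty]
        intro h
        have h1 : ∑ i, t.1 i = 1 := t.2.2
        have h2 : t.1 = 0 := by
          funext i; exact DFunLike.congr_fun h i
        rw [h2] at h1
        simp at h1⟩

/-- The weak topology: a set is open if and only if its intersection with every closed simplex is
open in the Euclidean topology of this simplex. -/
noncomputable instance Realization.topology : TopologicalSpace (Realization K) :=
  ⨆ (s : Finset V) (hs : s ∈ K.faces),
    TopologicalSpace.coinduced (Realization.ofFace K s hs) inferInstance

/-- `HPol_*`: the pointed spaces which have the pointed homotopy type of a pointed polyhedron, i.e.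
of the geometric realization of a simplicial complex pointed at any of its points. -/
def HPolPtd : ObjectProperty PtdTop.{u} := fun X =>
  ∃ (V : Type u) (K : AbstractSimplicialComplex V) (x : Realization K),
    Nonempty (X ≅ { carrier := Realization K, pt := x })

end Polyhedra

section Sphere

open scoped unitInterval Topology Topology.Homotopy

/-- Identify all boundary points of the cube `I^k`. -/
def sphereSetoid (k : ℕ) : Setoid (Fin k → I) where
  r a b := a = b ∨ (a ∈ Cube.boundary (Fin k) ∧ b ∈ Cube.boundary (Fin k))
  iseqv :=
    { refl := fun _ => .inl rfl
      symm := fun h => h.elim (fun h => .inl h.symm) fun h => .inr ⟨h.2, h.1⟩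
      trans := by
        rintro a b c (rfl | h) (rfl | h')
        exacts [.inl rfl, .inr h', .inr h, .inr ⟨h.1, h'.2⟩] }

/-- The `k`-sphere, `k ≥ 1`, as the quotient `I^k / ∂I^k` of the cube by its boundary, pointed at
the class of the boundary. -/
def sphere (k : ℕ) [NeZero k] : PtdTop.{u} where
  carrier := ULift.{u} (Quotient (sphereSetoid k))
  pt := ⟨Quotient.mk _ 0⟩

variable (k : ℕ) [NeZero k]

/-- The projection of the cube onto the sphere. -/
def cubeProj : C(Fin k → I, (sphere.{u} k).carrier) :=
  ⟨fun a => ⟨Quotient.mk _ a⟩, continuous_uliftUp.comp continuous_quotient_mk'⟩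

lemma isQuotientMap_cubeProj : Topology.IsQuotientMap (cubeProj.{u} k) :=
  Homeomorph.ulift.symm.isQuotientMap.comp isQuotientMap_quotient_mk'

lemma zero_mem_boundary : (0 : Fin k → I) ∈ Cube.boundary (Fin k) := ⟨0, .inl rfl⟩

lemma cubeProj_boundary {a : Fin k → I} (ha : a ∈ Cube.boundary (Fin k)) :
    cubeProj.{u} k a = (sphere.{u} k).pt :=
  congrArg ULift.up (Quotient.sound (.inr ⟨ha, zero_mem_boundary k⟩))

lemma eq_or_boundary {a b : Fin k → I} (h : cubeProj.{u} k a = cubeProj.{u} k b) :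
    a = b ∨ (a ∈ Cube.boundary (Fin k) ∧ b ∈ Cube.boundary (Fin k)) :=
  Quotient.exact (congrArg ULift.down h)

lemma factorsThrough_cubeProj {X : PtdTop.{u}} (g : Ω^ (Fin k) X.carrier X.pt) :
    Function.FactorsThrough g.1 (cubeProj.{u} k) := fun a b h => by
  obtain rfl | ⟨ha, hb⟩ := eq_or_boundary k h
  · rfl
  · exact (g.2 a ha).trans (g.2 b hb).symm

/-- Pointed maps out of the sphere are the same as maps of the cube which are constant on the
boundary. -/
noncomputable def sphereMapEquiv (X : PtdTop.{u}) :
    PtdMap (sphere.{u} k) X ≃ Ω^ (Fin k) X.carrier X.pt where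
  toFun f := ⟨f.1.comp (cubeProj k), fun a ha =>
    (congrArg f.1 (cubeProj_boundary k ha)).trans f.2⟩
  invFun g := ⟨(isQuotientMap_cubeProj k).lift g.1 (factorsThrough_cubeProj k g), by
      rw [← cubeProj_boundary k (zero_mem_boundary k)]
      exact (DFunLike.congr_fun ((isQuotientMap_cubeProj k).lift_comp g.1
        (factorsThrough_cubeProj k g)) 0).trans (g.2 _ (zero_mem_boundary k))⟩
  left_inv f := by
    refine Subtype.ext (ContinuousMap.ext fun x => ?_)
    obtain ⟨a, rfl⟩ := (isQuotientMap_cubeProj k).surjective x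
    exact DFunLike.congr_fun ((isQuotientMap_cubeProj k).lift_comp (f.1.comp (cubeProj k))
      fun _ _ h => congrArg f.1 h) a
  right_inv g := Subtype.ext
    ((isQuotientMap_cubeProj k).lift_comp g.1 (factorsThrough_cubeProj k g))

lemma sphereMap_homotopic_iff (X : PtdTop.{u}) (f g : PtdMap (sphere.{u} k) X) :
    f ≈ g ↔ GenLoop.Homotopic (sphereMapEquiv k X f) (sphereMapEquiv k X g) := by
  constructor
  · rintro ⟨F⟩
    refine ⟨⟨⟨⟨fun x => F (x.1, cubeProj k x.2), by fun_prop⟩, ?_, ?_⟩, ?_⟩⟩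
    · intro x; exact F.apply_zero _
    · intro x; exact F.apply_one _
    · intro t a ha
      exact F.eq_fst t (cubeProj_boundary k ha)
  · rintro ⟨F⟩
    have hF : ∀ t a b, cubeProj.{u} k a = cubeProj.{u} k b → F (t, a) = F (t, b) := by
      intro t a b h
      obtain rfl | ⟨ha, hb⟩ := eq_or_boundary k h
      · rfl
      · rw [F.eq_fst t ha, F.eq_fst t hb]
        exact (GenLoop.boundary _ a ha).trans (GenLoop.boundary _ b hb).symm
    choose s hs using (isQuotientMap_cubeProj.{u} k).surjective
    refine ⟨⟨⟨⟨fun x => F (x.1, s x.2), ?_⟩, ?_, ?_⟩, ?_⟩⟩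
    · refine (isQuotientMap_cubeProj.{u} k).continuous_lift_prod_right ?_
      have : (fun p : I × (Fin k → I) => F (p.1, s (cubeProj.{u} k p.2))) = fun p => F p := by
        funext p; exact hF _ _ _ (hs _)
      exact this ▸ F.continuous
    · intro x
      exact (F.apply_zero _).trans (congrArg f.1 (hs x))
    · intro x
      exact (F.apply_one _).trans (congrArg g.1 (hs x))
    · rintro t x rfl
      have : s (sphere.{u} k).pt ∈ Cube.boundary (Fin k) := by
        have h := (hs (sphere.{u} k).pt).trans (cubeProj_boundary k (zero_mem_boundary k)).symm
        obtain h | h := eq_or_boundary k h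
        · rw [h]; exact zero_mem_boundary k
        · exact h.1
      exact (F.eq_fst t this).trans (congrArg f.1 (hs _))

/-- Pointed homotopy classes of maps out of the sphere and the homotopy group of Mathlib. The
opposite appears since the product of two classes in the latter is the class of the concatenation
in reversed order. -/
noncomputable def sphereHomEquiv (X : PtdTop.{u}) :
    (sphere.{u} k ⟶ X) ≃ (HomotopyGroup (Fin k) X.carrier X.pt)ᵐᵒᵖ :=
  (Quotient.congr (sphereMapEquiv k X) (sphereMap_homotopic_iff k X)).trans
    MulOpposite.opEquiv

/-- The group structure on the set `[(S^k, *), (X, x)]` of pointed homotopy classes: the group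
`π_k(X, x)`, where the product of `f` and `g` is given by the concatenation of `f` and `g`. -/
noncomputable instance sphereCogroup : Cogroup (sphere.{u} k) where
  group X := (sphereHomEquiv k X).group
  mul_comp {X Y} f g h := by
    let _ (Z : PtdTop.{u}) : Group (sphere.{u} k ⟶ Z) := (sphereHomEquiv k Z).group
    induction f using Quotient.inductionOn with | _ f => ?_
    induction g using Quotient.inductionOn with | _ g => ?_
    induction h using Quotient.inductionOn with | _ h => ?_
    have key : ∀ (Z : PtdTop.{u}) (a b : PtdMap (sphere.{u} k) Z),
        (a.hclass * b.hclass : sphere.{u} k ⟶ Z) = PtdMap.hclass ((sphereMapEquiv k Z).symm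
          (GenLoop.transAt 0 (sphereMapEquiv k Z a) (sphereMapEquiv k Z b))) := by
      intro Z a b
      refine (sphereHomEquiv k Z).injective ?_
      refine ((sphereHomEquiv k Z).mulEquiv.map_mul _ _).trans ?_
      refine MulOpposite.unop_injective ?_
      refine (HomotopyGroup.mul_spec (i := 0)).trans ?_
      change _ = Quotient.mk _ (sphereMapEquiv k Z _)
      rw [Equiv.apply_symm_apply]
    change (f.hclass * g.hclass) ≫ h.hclass = (f.comp h).hclass * (g.comp h).hclass
    rw [key, key]
    refine congrArg PtdMap.hclass ((sphereMapEquiv k Y).injective ?_)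
    rw [Equiv.apply_symm_apply]
    refine GenLoop.ext _ _ fun t => ?_
    have e : sphereMapEquiv k X ((sphereMapEquiv k X).symm
        (GenLoop.transAt 0 (sphereMapEquiv k X f) (sphereMapEquiv k X g))) = _ :=
      Equiv.apply_symm_apply _ _
    refine (congrArg h.1 (DFunLike.congr_fun e t)).trans ?_
    simp only [GenLoop.transAt, GenLoop.coe_copy]
    split_ifs <;> rfl

end Sphere

section CoarsePi

variable (k : ℕ) [NeZero k]

/-- The topological coarse shape homotopy group `Sh^*((S^k, *), (X, x))` of a pointed space. -/
noncomputable def coarsePi (X : PtdTop.{u}) [HasExpansion.{u} HPolPtd.{u} X] : TopGrp.{u + 1} :=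
  shGrp.{u} HPolPtd.{u} (sphere.{u} k) X

/-- The inverse system of the topological groups `Sh^*((S^k, *), (T_a, t_a))`. -/
noncomputable def coarsePiSys (T : InvSys.{w} PtdTop.{u})
    [∀ a, HasExpansion.{u} HPolPtd.{u} (T.obj a)] : InvSys.{w} TopGrp.{u + 1} :=
  shSys.{u} HPolPtd.{u} (sphere.{u} k) T

instance {X : PtdTop.{u}} (p : Expansion.{w} HPolPtd.{u} X) (a : p.sys.Idx) :
    HasExpansion.{u} HPolPtd.{u} (p.sys.obj a) := .of_mem (p.isExpansion.mem a)

/-- For an expansion `p` of `X`, the induced projection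
`Sh^*((S^k, *), (X, x)) ⟶ Sh^*((S^k, *), (X_a, x_a))`. -/
noncomputable def coarsePiProj {X : PtdTop.{u}} [HasExpansion.{u} HPolPtd.{u} X]
    (p : Expansion.{u} HPolPtd.{u} X) (a : p.sys.Idx) :
    coarsePi k X ⟶ (coarsePiSys k p.sys).obj a :=
  shGrpMap.{u} HPolPtd.{u} (sphere.{u} k) (p.proj a)

/-- For an expansion `p` of `X`: the induced morphism `p_*` from `Sh^*((S^k, *), (X, x))` to the
inverse system `Sh^*((S^k, *), (X_a, x_a))` is an `HPol_*`-expansion, the groups being regarded as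
spaces pointed at their units. -/
def IsExpansionCoarsePi {X : PtdTop.{u}} [HasExpansion.{u} HPolPtd.{u} X]
    (p : Expansion.{u} HPolPtd.{u} X) : Prop :=
  IsExpansion HPolPtd.{u + 1} (TopGrp.toPtd.obj (coarsePi k X))
    ((coarsePiSys k p.sys).mapFunctor TopGrp.toPtd)
    fun a => TopGrp.toPtd.map (coarsePiProj k p a)

end CoarsePi

end CoarseShape

open CoarseShape

/-! Everything about movability rests on two facts: functors preserve movability, and movability of
the system of an expansion does not depend on the expansion.

For the first assertion, `Sh^*(S, -)` is a covariant functor into topological groups. It therefore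
carries the morphisms `r` that witness movability (uniform or not) to continuous homomorphisms
satisfying the same equations. If `Y` lies in `HPol_*`, then `Y` is its own expansion, and its basic
open sets are single points, so `Sh^*(S, Y)` is discrete.

For (2a), some expansion of `X` has a movable system, hence the given `p` has one too
(`Expansion.isMovable_of_isMovable`). Applying `Sh^*(S^k, -)` and then forgetting to pointed spaces
shows that the target system of `p_*` is movable. Since `p_*` is assumed to be an expansion, it
witnesses movability of the group.

For (2b), the terms `X_a` lie in `HPol_*`, so `Sh^*(S^k, X_a)` is discrete, and compactness makes it
finite. But this group consists of sequences in `[S^k, X_a]` modulo eventual equality, and such a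
set is infinite as soon as `[S^k, X_a]` has two elements (`Sh.subsingleton_hom_of_finite`). Hence
every `[S^k, X_a]` is trivial, all the coarse shape groups involved are one-point spaces, and `p_*`
is an expansion for trivial reasons (`isExpansion_of_subsingleton`). Movability then follows from
(2a). -/

namespace CoarseShape

/-! ### Movability under functors and under change of expansion. -/

section Movability

variable {C : Type u} [Category.{v} C]

lemma InvSys.IsMovable.mapFunctor {D : Type*} [Category D] (F : C ⥤ D) {T : InvSys.{w} C}
    (hT : T.IsMovable) : (T.mapFunctor F).IsMovable := by
  intro a
  obtain ⟨b, hab, H⟩ := hT a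
  refine ⟨b, hab, fun c hac => ?_⟩
  obtain ⟨r, hr⟩ := H c hac
  exact ⟨F.map r, (F.map_comp _ _).symm.trans (congrArg F.map hr)⟩

variable {P : ObjectProperty C}

/-- Movability of the inverse system of an expansion does not depend on the expansion. -/
lemma Expansion.isMovable_of_isMovable {X : C} (q : Expansion.{w₁} P X) (p : Expansion.{w₂} P X)
    (hq : q.sys.IsMovable) : p.sys.IsMovable := by
  intro a
  have hp := p.isExpansion
  have hq' := q.isExpansion
  -- A zigzag between the two systems: `a` is pulled back to `b` in `q`, movability of `q` gives
  -- `b'` for `b`, and `g` returns to `p` at `a₀`.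
  obtain ⟨b, f, hf⟩ := hq'.factor (hp.mem a) (p.proj a)
  obtain ⟨b', hbb', H⟩ := hq b
  obtain ⟨a₀, g, hg⟩ := hp.factor (hq'.mem b') (q.proj b')
  obtain ⟨a₁, ha₁, ha₀⟩ := exists_ge_ge a a₀
  -- The round trip through `q` agrees with the bonding morphism only after precomposition with the
  -- projection of `X`; (E2) makes them equal from `a₂` on. This `a₂` is the movability index of
  -- `a`, and it is chosen before `c`.
  obtain ⟨a₂, ha₂, e⟩ := hp.eventually_eq (hp.mem a)
    (p.sys.bond ha₀ ≫ g ≫ q.sys.bond hbb' ≫ f) (p.sys.bond ha₁) (by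
      rw [← Category.assoc, hp.comm, ← Category.assoc, hg, ← Category.assoc, hq'.comm, hf, hp.comm])
  rw [p.sys.bond_trans_assoc, p.sys.bond_trans] at e
  refine ⟨a₂, ha₁.trans ha₂, fun c hac => ?_⟩
  obtain ⟨d₀, h, hh⟩ := hq'.factor (hp.mem c) (p.proj c)
  obtain ⟨d, hd₀, hbd⟩ := exists_ge_ge d₀ b
  -- Two ways from `q` down to the term at `a`: through `c` by `h`, or through `b` by `f`. By (E2)
  -- they coincide from `d'` on, so `d'` is the index into which movability of `q` has to lift.
  obtain ⟨d', hdd', e'⟩ := hq'.eventually_eq (hp.mem a)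
    (q.sys.bond hd₀ ≫ h ≫ p.sys.bond hac) (q.sys.bond hbd ≫ f) (by
      rw [← Category.assoc, hq'.comm, ← Category.assoc, hh, hp.comm, ← Category.assoc, hq'.comm, hf])
  rw [q.sys.bond_trans_assoc, q.sys.bond_trans_assoc] at e'
  obtain ⟨r, hr⟩ := H d' (hbd.trans hdd')
  -- Over to `q` at `b'`, up to `d'` by `r`, and back to `p` at `c`. Composing with the bond to `a`,
  -- `e'` replaces the path through `c` by the one through `b`, `hr` removes `r`, and `e` identifies
  -- the rest.
  refine ⟨p.sys.bond (ha₀.trans ha₂) ≫ g ≫ r ≫ q.sys.bond (hd₀.trans hdd') ≫ h, ?_⟩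
  simp only [Category.assoc]
  rw [e', ← Category.assoc r, hr, e]

end Movability

/-! ### Systems of coarse shape groups, and what compactness forces. -/

section ShSystem

variable {C : Type u} [Category.{v} C] {P : ObjectProperty C} {S : C}

lemma shGrpMap_comp [Cogroup S] {X Y Z : C} {f : X ⟶ Y} {g : Y ⟶ Z} {h : X ⟶ Z} (e : f ≫ g = h) [HasExpansion.{w} P X]
    [HasExpansion.{w} P Y] [HasExpansion.{w} P Z] :
    shGrpMap.{w} P S f ≫ shGrpMap.{w} P S g = shGrpMap.{w} P S h := by
  subst e
  exact ContinuousMonoidHom.ext fun F => (Sh.map_comp f g (show Sh.{w} P S X from F)).symm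

lemma InvSys.IsMovable.shSys [Cogroup S] {T : InvSys.{w₁} C}
    [∀ a, HasExpansion.{w} P (T.obj a)] (hT : T.IsMovable) :
    (shSys.{w} P S T).IsMovable := by
  intro (a : T.Idx)
  obtain ⟨b, hab, H⟩ := hT a
  refine ⟨b, hab, fun (c : T.Idx) hac => ?_⟩
  obtain ⟨r, hr⟩ := H c hac
  exact ⟨shGrpMap.{w} P S r,
    shGrpMap_comp hr⟩

lemma InvSys.IsUniformlyMovable.shSys [Cogroup S] {T : InvSys.{w₁} C}
    [∀ a, HasExpansion.{w} P (T.obj a)] (hT : T.IsUniformlyMovable) :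
    (shSys.{w} P S T).IsUniformlyMovable := by
  intro (a : T.Idx)
  obtain ⟨b, hab, r, hr, hra⟩ := hT a
  exact ⟨b, hab, fun c : T.Idx => shGrpMap.{w} P S (r c),
    fun {c d : T.Idx} hcd => shGrpMap_comp (hr hcd),
    by dsimp only; rw [hra]; rfl⟩

/-- For `K` in `P`, the elements of `Sh^*(S, K)` are the sequences of morphisms `S ⟶ K` up to
eventual equality, so that there are infinitely many of them as soon as there are two distinct
morphisms `S ⟶ K`. -/
lemma Sh.subsingleton_hom_of_finite {K : C} (hK : P K) [Finite (Sh.{w} P S K)] :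
    Subsingleton (S ⟶ K) := by
  classical
  by_contra hS
  rw [not_subsingleton_iff_nontrivial] at hS
  obtain ⟨f, g, hfg⟩ := exists_pair_ne (S ⟶ K)
  -- `Nat.unpair` splits `ℕ` into infinitely many infinite blocks. The sequence `t m` is `f` on
  -- block `m` and `g` elsewhere, so distinct `t m` differ infinitely often.
  let t : ℕ → SStarMor (rud.{w} S) (rud.{w} K) := fun m =>
    .ofRud (fun i _ => if (Nat.unpair i).1 = m then f else g)
      fun _ => ⟨0, fun _ _ => Category.comp_id _⟩
  refine not_injective_infinite_finite
    (fun m => Sh.mk (Expansion.ofMem hK) (Quotient.mk _ (t m)) : ℕ → Sh.{w} P S K) ?_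
  intro m m' h
  have h' := Quotient.exact ((Sh.repEquiv (Expansion.ofMem.{w} hK)).symm.injective h)
  obtain ⟨n, H⟩ := SStarMor.term_equiv h' PUnit.unit
  -- The position `Nat.pair m n` lies in block `m` and is at least `n`, hence within the range where
  -- the two sequences agree.
  have e : (if (Nat.unpair (Nat.pair m n)).1 = m then f else g) =
      if (Nat.unpair (Nat.pair m n)).1 = m' then f else g := H _ (Nat.right_le_pair m n)
  rw [Nat.unpair_pair, if_pos rfl] at e
  by_contra hm
  rw [if_neg hm] at e
  exact hfg e

lemma Sh.subsingleton_hom_of_compactSpace {K : C} (hK : P K) [CompactSpace (Sh.{w} P S K)] :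
    Subsingleton (S ⟶ K) := by
  have := Sh.discreteTopology.{w} (S := S) hK
  have : Finite (Sh.{w} P S K) := finite_of_compact_of_discrete
  exact Sh.subsingleton_hom_of_finite.{w} hK

/-- A coarse shape morphism out of `S` is determined by its terms `S ⟶ q.sys.obj l`, and here each
term has at most one possible value. -/
lemma Sh.subsingleton_of_expansion {Y : C} (q : Expansion.{w} P Y)
    (h : ∀ l, Subsingleton (S ⟶ q.sys.obj l)) : Subsingleton (Sh.{w} P S Y) := by
  refine (Sh.repEquiv q).subsingleton_congr.2 ⟨fun f g => ?_⟩
  induction f using Quotient.inductionOn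
  induction g using Quotient.inductionOn
  exact Quotient.sound (SStarMor.equiv_of_term fun m => ⟨0, fun _ _ => Subsingleton.elim _ _⟩)

end ShSystem

/-! ### One-point spaces and their expansions. -/

section Points

/-- A pointed map is prescribed at the base point. Only the source has to be a point, since the
target in (E1) and (E2) is an arbitrary polyhedron. -/
lemma PtdTop.subsingleton_hom (X Y : PtdTop.{u}) [Subsingleton X.carrier] :
    Subsingleton (X ⟶ Y) := by
  refine ⟨fun f g => ?_⟩
  induction f using Quotient.inductionOn with | _ f => ?_
  induction g using Quotient.inductionOn with | _ g => ?_
  refine congrArg PtdMap.hclass (Subtype.ext (ContinuousMap.ext fun x => ?_))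
  rw [Subsingleton.elim x X.pt, f.2, g.2]

/-- The constant map. -/
def PtdTop.const (X Y : PtdTop.{u}) : X ⟶ Y :=
  PtdMap.hclass ⟨.const _ Y.pt, rfl⟩

/-- The simplicial complex with a single vertex. -/
def pointComplex : AbstractSimplicialComplex PUnit.{u + 1} where
  faces := {s | s.Nonempty}
  isRelLowerSet_faces := by
    intro s hs
    exact ⟨hs, fun t _ ht => ht⟩
  singleton_mem v := Finset.singleton_nonempty v

lemma subsingleton_realization_pointComplex : Subsingleton (Realization pointComplex.{u}) := by
  -- With only one vertex, the sum of the barycentric coordinates is the coordinate itself.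
  have key : ∀ t : Realization pointComplex.{u}, t.1 PUnit.unit = 1 := fun t => by
    have h := t.2.2.1
    rwa [Finsupp.sum_fintype _ _ fun _ => rfl, Fintype.sum_unique] at h
  exact ⟨fun s t => Subtype.ext (Finsupp.ext fun _ => (key s).trans (key t).symm)⟩

lemma HPolPtd_of_subsingleton (X : PtdTop.{u}) [Subsingleton X.carrier] : HPolPtd.{u} X := by
  have := subsingleton_realization_pointComplex.{u}
  let x : Realization pointComplex.{u} := ⟨Finsupp.single PUnit.unit 1, by
    refine ⟨fun v => ?_, Finsupp.sum_single_index rfl, ?_⟩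
    · rw [Subsingleton.elim v PUnit.unit, Finsupp.single_eq_same]; exact zero_le_one
    · exact Finsupp.support_nonempty_iff.2 (Finsupp.single_ne_zero.2 one_ne_zero)⟩
  let Y : PtdTop.{u} := { carrier := Realization pointComplex.{u}, pt := x }
  have : Subsingleton Y.carrier := subsingleton_realization_pointComplex.{u}
  exact ⟨PUnit, pointComplex, x, ⟨
    { hom := X.const Y
      inv := Y.const X
      hom_inv_id := (PtdTop.subsingleton_hom X X).elim _ _
      inv_hom_id := (PtdTop.subsingleton_hom Y Y).elim _ _ }⟩⟩

/-- A one-point space is the limit, in the sense of expansions, of any system of one-point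
spaces. -/
lemma isExpansion_of_subsingleton (X : PtdTop.{u}) (T : InvSys.{w} PtdTop.{u})
    (p : ∀ l, X ⟶ T.obj l) [Subsingleton X.carrier] [∀ l, Subsingleton (T.obj l).carrier] :
    IsExpansion HPolPtd.{u} X T p where
  mem l := HPolPtd_of_subsingleton (T.obj l)
  comm _ := (PtdTop.subsingleton_hom _ _).elim _ _
  factor {K} _ _ :=
    ⟨Classical.arbitrary _, PtdTop.const _ K, (PtdTop.subsingleton_hom _ _).elim _ _⟩
  eventually_eq {_} _ l _ _ _ := ⟨l, le_rfl, (PtdTop.subsingleton_hom _ _).elim _ _⟩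

end Points

/-! ### The induced morphism `p_*` and movability of the coarse shape homotopy group. -/

section CoarsePi

variable (k : ℕ) [NeZero k] {X : PtdTop.{u}} [HasExpansion.{u} HPolPtd.{u} X]
  (p : Expansion.{u} HPolPtd.{u} X)

/-- If the coarse shape groups of the terms of an expansion are compact, they are finite, being
discrete; hence the terms have trivial `k`-th homotopy groups, and all coarse shape groups in
question are trivial. -/
lemma isExpansionCoarsePi_of_compactSpace
    (h : ∀ a, CompactSpace (coarsePi k (p.sys.obj a)).carrier) : IsExpansionCoarsePi k p := by
  have hS : ∀ a, Subsingleton (sphere.{u} k ⟶ p.sys.obj a) := fun a =>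
    have : CompactSpace (Sh.{u} HPolPtd.{u} (sphere.{u} k) (p.sys.obj a)) := h a
    Sh.subsingleton_hom_of_compactSpace.{u} (p.isExpansion.mem a)
  -- The group of `X` is computed through `p`, and below the group of each term through its
  -- rudimentary expansion; in both cases triviality of the `[S^k, X_a]` suffices.
  have : Subsingleton (TopGrp.toPtd.obj (coarsePi k X)).carrier :=
    Sh.subsingleton_of_expansion p hS
  have : ∀ a, Subsingleton
      (((coarsePiSys k p.sys).mapFunctor TopGrp.toPtd).obj a).carrier := fun a =>
    Sh.subsingleton_of_expansion (.ofMem (p.isExpansion.mem a)) fun _ => hS a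
  exact isExpansion_of_subsingleton _ _ _

/-- The expansion `q` that witnesses movability of `X` need not be `p`, whereas the hypothesis on
`p_*` concerns `p`; independence of the expansion bridges the two. -/
lemma isMovableObj_coarsePi (hX : IsMovableObj.{u} HPolPtd.{u} X)
    (h : IsExpansionCoarsePi k p) :
    IsMovableObj.{u} HPolPtd.{u + 1} (TopGrp.toPtd.obj (coarsePi k X)) := by
  obtain ⟨q, hq⟩ := hX
  have hp : (coarsePiSys k p.sys).IsMovable := (q.isMovable_of_isMovable p hq).shSys
  exact ⟨⟨_, _, h⟩, hp.mapFunctor TopGrp.toPtd⟩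

end CoarsePi

end CoarseShape

theorem lemma5p3 (k : ℕ) [NeZero k] :
    (∀ (T : InvSys.{w} PtdTop.{u}) [∀ a, HasExpansion.{u} HPolPtd.{u} (T.obj a)],
      (T.IsMovable → (coarsePiSys k T).IsMovable) ∧
      (T.IsUniformlyMovable → (coarsePiSys k T).IsUniformlyMovable) ∧
      ((∀ a, HPolPtd.{u} (T.obj a)) →
        ∀ a, DiscreteTopology ((coarsePiSys k T).obj a).carrier)) ∧
    (∀ (X : PtdTop.{u}) [HasExpansion.{u} HPolPtd.{u} X],
      IsMovableObj.{u} HPolPtd.{u} X → ∀ p : Expansion.{u} HPolPtd.{u} X,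
        (IsExpansionCoarsePi k p →
          IsMovableObj.{u} HPolPtd.{u + 1} (TopGrp.toPtd.obj (coarsePi k X))) ∧
        ((∀ a, CompactSpace (coarsePi k (p.sys.obj a)).carrier) →
          IsExpansionCoarsePi k p ∧
          IsMovableObj.{u} HPolPtd.{u + 1} (TopGrp.toPtd.obj (coarsePi k X)))) := by
  refine ⟨fun T _ => ⟨fun hT => hT.shSys, fun hT => hT.shSys, fun hT a =>
    Sh.discreteTopology (hT a)⟩, fun X _ hX p => ⟨isMovableObj_coarsePi k p hX, fun h => ?_⟩⟩
  have hp := isExpansionCoarsePi_of_compactSpace k p h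
  exact ⟨hp, isMovableObj_coarsePi k p hX hp⟩
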